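/- Let $n\ge 0$ and equip $\mathbb{R}^{2n+1}$, with coordinates $(x_1,\dots,x_n,y_1,\dots,y_n,z)$, with its standard Sasakian structure $(\phi,\xi,\eta,g)$: $$\eta=dz-\sum_{k=1}^n y_k\,dx_k,\qquad \xi=\frac{\partial}{\partial z},\qquad g=\eta\otimes\eta+\tfrac12\sum_{k=1}^n\big((dx_k)^2+(dy_k)^2\big),$$ $$\phi\frac{\partial}{\partial y_k}=\frac{\partial}{\partial x_k}+y_k\frac{\partial}{\partial z},\qquad \phi\frac{\partial}{\partial x_k}=-\frac{\partial}{\partial y_k},\qquad \phi\frac{\partial}{\partial z}=0,$$ where $d$ is normalized by $2\,d\eta(X,Y)=X(\eta(Y))-Y(\eta(X))-\eta([X,Y])$. Let $L$ be the tangent bundle of a Legendrian foliation $\mathcal F'$ of $(\mathbb{R}^{2n+1},\eta)$, i.e. a smooth, integrable rank-$n$ subbundle of $\ker\eta$ on which $d\eta$ vanishes, and let $Q=\phi L$ be its conjugate distribution. Let $\nabla$ be the bi-Legendrian connection of $(L,Q)$, i.e. the linear connection such that, with $V_L,V_Q$ denoting the components of a vector field $V$ in the splitting $L\oplus Q\oplus\mathbb{R}\xi$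 of the tangent bundle, 1. $\nabla L\subset L$, $\nabla Q\subset Q$ and $\nabla(\mathbb{R}\xi)\subset\mathbb{R}\xi$; 2. $\nabla d\eta=0$; 3. the torsion $T$ of $\nabla$ satisfies $T(X,Y)=2\,d\eta(X,Y)\,\xi$ for all sections $X$ of $L$ and $Y$ of $Q$, and $T(V,\xi)=[\xi,V_L]_Q+[\xi,V_Q]_L$ for all vector fields $V$. Assume that $\mathcal F'$ is flat, i.e. $(\mathcal L_X\mathcal L_{X'}\eta)(\xi)=0$ for all sections $X,X'$ of $L$, that $Q$ is integrable, and that $\nabla g=0$. Then the curvature of $\nabla$ vanishes identically: for all smooth vector fields $U,V,W$ on $\mathbb{R}^{2n+1}$, $$\nabla_U\nabla_VW-\nabla_V\nabla_UW-\nabla_{[U,V]}W=0.$$ -/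

import Mathlib

open scoped Manifold ContDiff Topology
open VectorField

noncomputable section

namespace SasakiR

/-! ### The standard Sasakian structure of `ℝ^{2n+1}` -/

/-- `ℝ^{2n+1}`, with coordinates `x_1, …, x_n, y_1, …, y_n, z` indexed by
`Fin n ⊕ Fin n ⊕ Unit`. -/
abbrev RSpace (n : ℕ) : Type := EuclideanSpace ℝ (Fin n ⊕ Fin n ⊕ Unit)

variable {n : ℕ}

/-- The coordinate `x_k`, as a linear form; it is also the constant `1`-form `dx_k`. -/
def dx (k : Fin n) : RSpace n →L[ℝ] ℝ := EuclideanSpace.proj (Sum.inl k)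

/-- The coordinate `y_k`, as a linear form; it is also the constant `1`-form `dy_k`. -/
def dy (k : Fin n) : RSpace n →L[ℝ] ℝ := EuclideanSpace.proj (Sum.inr (Sum.inl k))

/-- The coordinate `z`, as a linear form; it is also the constant `1`-form `dz`. -/
def dz : RSpace n →L[ℝ] ℝ := EuclideanSpace.proj (Sum.inr (Sum.inr ()))

/-- The coordinate vector `∂/∂x_k`. -/
def ex (k : Fin n) : RSpace n := EuclideanSpace.single (Sum.inl k) 1

/-- The coordinate vector `∂/∂y_k`. -/
def ey (k : Fin n) : RSpace n := EuclideanSpace.single (Sum.inr (Sum.inl k)) 1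

/-- The coordinate vector `∂/∂z`. -/
def ez : RSpace n := EuclideanSpace.single (Sum.inr (Sum.inr ())) 1

/-- The contact form `η = dz - ∑ y_k dx_k`. -/
def eta (p : RSpace n) : RSpace n →L[ℝ] ℝ := dz - ∑ k, dy k p • dx k

/-- The Reeb vector field `ξ = ∂/∂z`. -/
def xi (_p : RSpace n) : RSpace n := ez

/-- The metric `g = η ⊗ η + ½ ∑ (dx_k² + dy_k²)`. -/
def metric (p v w : RSpace n) : ℝ :=
  eta p v * eta p w + 1 / 2 * ∑ k, (dx k v * dx k w + dy k v * dy k w)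

/-- The tensor field `φ`, with matrix `((0, I, 0), (-I, 0, 0), (0, y, 0))`:
it maps `∂/∂y_k` to `∂/∂x_k + y_k ∂/∂z`, `∂/∂x_k` to `-∂/∂y_k` and `∂/∂z` to `0`. -/
def phi (p : RSpace n) : RSpace n →L[ℝ] RSpace n :=
  ∑ k, ((dy k).smulRight (ex k + dy k p • ez) - (dx k).smulRight (ey k))

/-- The exterior derivative of a `1`-form, in the normalization
`2 dα(X, Y) = X(α(Y)) - Y(α(X)) - α([X, Y])`, that is `2 u ∧ v = u ⊗ v - v ⊗ u`. -/
def extD (α : RSpace n → RSpace n →L[ℝ] ℝ) (p v w : RSpace n) : ℝ :=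
  1 / 2 * (fderiv ℝ α p v w - fderiv ℝ α p w v)

/-- The `2`-form `dη`. -/
def dEta (p v w : RSpace n) : ℝ := extD eta p v w

/-! ### Vector fields and distributions -/

/-- Smooth vector fields on `ℝ^{2n+1}`. -/
def IsSmoothField (V : RSpace n → RSpace n) : Prop := ContDiff ℝ ∞ V

/-- `X` is a smooth section of the distribution `L`. -/
def IsSection (L : RSpace n → Submodule ℝ (RSpace n)) (X : RSpace n → RSpace n) : Prop :=
  IsSmoothField X ∧ ∀ p, X p ∈ L p

/-- `L` is a smooth subbundle of rank `r` of the tangent bundle: near every point it has a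
smooth frame with `r` members. -/
def IsSubbundle (r : ℕ) (L : RSpace n → Submodule ℝ (RSpace n)) : Prop :=
  ∀ p, ∃ U : Set (RSpace n), IsOpen U ∧ p ∈ U ∧ ∃ X : Fin r → RSpace n → RSpace n,
    (∀ i, ContDiffOn ℝ ∞ (X i) U) ∧
    ∀ q ∈ U, LinearIndependent ℝ (fun i => X i q) ∧
      Submodule.span ℝ (Set.range fun i => X i q) = L q

/-- Integrability of a distribution: it is closed under the Lie bracket. -/
def IsIntegrable (L : RSpace n → Submodule ℝ (RSpace n)) : Prop :=
  ∀ X Y, IsSection L X → IsSection L Y → IsSection L (lieBracket ℝ X Y)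

/-- Legendrian distributions of `(ℝ^{2n+1}, η)`: subbundles of rank `n` of the contact
distribution `ker η` on which `dη` vanishes. -/
structure IsLegendrianDistribution (L : RSpace n → Submodule ℝ (RSpace n)) : Prop where
  subbundle : IsSubbundle n L
  contact : ∀ p, ∀ v ∈ L p, eta p v = 0
  isotropic : ∀ p, ∀ v ∈ L p, ∀ w ∈ L p, dEta p v w = 0

/-- Legendrian foliations, represented by their tangent bundles: integrable Legendrian
distributions. -/
structure IsLegendrianFoliation (L : RSpace n → Submodule ℝ (RSpace n)) : Prop where
  legendrian : IsLegendrianDistribution L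
  integrable : IsIntegrable L

/-- The Lie derivative of a `1`-form,
`(𝓛_X α)(Y) = X(α(Y)) - α([X, Y]) = (D_X α)(Y) + α(D_Y X)`. -/
def lieDeriv (X : RSpace n → RSpace n) (α : RSpace n → RSpace n →L[ℝ] ℝ) :
    RSpace n → RSpace n →L[ℝ] ℝ :=
  fun p => fderiv ℝ α p (X p) + (α p).comp (fderiv ℝ X p)

/-- The form `Π(X, X') = -(𝓛_X 𝓛_{X'} η)(ξ)` on the sections of a Legendrian foliation. -/
def pangForm (X X' : RSpace n → RSpace n) (p : RSpace n) : ℝ :=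
  -(lieDeriv X (lieDeriv X' eta) p (xi p))

/-- A Legendrian foliation is flat if the form `Π` vanishes identically. -/
def IsFlatFoliation (L : RSpace n → Submodule ℝ (RSpace n)) : Prop :=
  ∀ X X', IsSection L X → IsSection L X' → ∀ p, pangForm X X' p = 0

/-- The conjugate distribution `Q = φ L`. -/
def conjugate (L : RSpace n → Submodule ℝ (RSpace n)) : RSpace n → Submodule ℝ (RSpace n) :=
  fun p => (L p).map (phi p).toLinearMap

/-! ### Linear connections and the bi-Legendrian connection -/

/-- Linear connections on `ℝ^{2n+1}`, that is covariant derivatives on its tangent bundle. -/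
abbrev Connection (n : ℕ) : Type :=
  CovariantDerivative 𝓘(ℝ, RSpace n) (RSpace n)
    (TangentSpace 𝓘(ℝ, RSpace n) : RSpace n → Type)

/-- The vector field `∇_V W`. -/
def nabla (D : Connection n) (V W : RSpace n → RSpace n) : RSpace n → RSpace n :=
  fun p => D W p (V p)

/-- The torsion `T(V, W) = ∇_V W - ∇_W V - [V, W]`. -/
def torsionField (D : Connection n) (V W : RSpace n → RSpace n) : RSpace n → RSpace n :=
  fun p => nabla D V W p - nabla D W V p - lieBracket ℝ V W p

/-- The curvature `R(U, V)W = ∇_U ∇_V W - ∇_V ∇_U W - ∇_{[U, V]} W`. -/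
def curvatureField (D : Connection n) (U V W : RSpace n → RSpace n) : RSpace n → RSpace n :=
  fun p => nabla D U (nabla D V W) p - nabla D V (nabla D U W) p
    - nabla D (lieBracket ℝ U V) W p

/-- `∇ B = 0`, for a field `B` of bilinear forms:
`V(B(W, Z)) = B(∇_V W, Z) + B(W, ∇_V Z)`. -/
def IsParallel (D : Connection n) (B : RSpace n → RSpace n → RSpace n → ℝ) : Prop :=
  ∀ V W Z, IsSmoothField V → IsSmoothField W → IsSmoothField Z → ∀ p,
    fderiv ℝ (fun q => B q (W q) (Z q)) p (V p)
      = B p (nabla D V W p) (Z p) + B p (W p) (nabla D V Z p)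

/-- `∇ L ⊂ L`: covariant derivatives of sections of `L` lie in `L`. -/
def Preserves (D : Connection n) (L : RSpace n → Submodule ℝ (RSpace n)) : Prop :=
  ∀ V X, IsSmoothField V → IsSection L X → ∀ p, nabla D V X p ∈ L p

/-- The line bundle `ℝξ`. -/
def reebLine : RSpace n → Submodule ℝ (RSpace n) := fun p => Submodule.span ℝ {xi p}

open Classical in
/-- The component `V_A` of a vector field `V` in `A`, with respect to the splitting
`A ⊕ B ⊕ ℝξ` of the tangent bundle (and `0` at points where `A`, `B` and `ℝξ` do not split
the tangent space). -/
def component (A B : RSpace n → Submodule ℝ (RSpace n)) (V : RSpace n → RSpace n) :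
    RSpace n → RSpace n :=
  fun p => if h : IsCompl (A p) (B p ⊔ reebLine p) then
    (A p).projection (B p ⊔ reebLine p) h (V p) else 0

/-- `D` is the bi-Legendrian connection of the pair `(L₁, L₂)` of transversal Legendrian
distributions: it preserves `L₁`, `L₂` and `ℝξ`, `dη` is parallel,
`T(X, Y) = 2 dη(X, Y) ξ` for sections `X` of `L₁` and `Y` of `L₂`, and
`T(V, ξ) = [ξ, V_{L₁}]_{L₂} + [ξ, V_{L₂}]_{L₁}` for all `V`. -/
structure IsBiLegendrianConnection (L₁ L₂ : RSpace n → Submodule ℝ (RSpace n))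
    (D : Connection n) : Prop where
  preserves_left : Preserves D L₁
  preserves_right : Preserves D L₂
  preserves_reeb : Preserves D reebLine
  parallel_dEta : IsParallel D dEta
  torsion_mixed : ∀ X Y, IsSection L₁ X → IsSection L₂ Y → ∀ p,
    torsionField D X Y p = (2 * dEta p (X p) (Y p)) • xi p
  torsion_reeb : ∀ V, IsSmoothField V → ∀ p,
    torsionField D V xi p
      = component L₂ L₁ (lieBracket ℝ xi (component L₁ L₂ V)) p
        + component L₁ L₂ (lieBracket ℝ xi (component L₂ L₁ V)) p

end SasakiR

end

open scoped Manifold ContDiff Topology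
open VectorField

noncomputable section

namespace SasakiR

variable {n : ℕ}

/-! ### Coordinate formulas -/

/-! The frame `∂/∂x_k + y_k ∂/∂z`, `∂/∂y_k`, `∂/∂z` is parallel for a flat reference connection
`∇⁰_V W = D_V W - beta(V, W) ξ`, with `D_V` the coordinate derivative. Both `g` and `dη` have
constant coefficients in this frame, and the torsion of `∇⁰` is `2 dη ⊗ ξ`. The claim is that the
bi-Legendrian connection equals `∇⁰`; its difference `A` from `∇⁰` is `diffTensor`.

The tensor `A` is symmetric (`diffTensor_comm`). On `L × Q` the prescribed torsion is that of `∇⁰`.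
Flatness makes `L`, and hence `Q = φL`, invariant under bracket with `ξ`, so `T(·, ξ) = 0`. On `L ×
L`, integrability puts the antisymmetrization of `A` in `L`, while skewness of `A` for `dη` puts it
in `Q`, so it vanishes; `Q × Q` is alike.

As `∇g = 0`, `A` is also skew for `g`. Symmetric in one pair of slots and skew in another, it is
zero (`diffTensor_eq_zero`), and the curvature is that of `∇⁰` (`curvatureField_eq_zero`). -/

@[simp] lemma dx_ex (j k : Fin n) : dx j (ex k) = if j = k then 1 else 0 := by
  simp [dx, ex]

@[simp] lemma dx_ey (j k : Fin n) : dx j (ey k) = 0 := by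
  simp [dx, ey]

@[simp] lemma dx_ez (j : Fin n) : dx j (ez : RSpace n) = 0 := by
  simp [dx, ez]

@[simp] lemma dy_ex (j k : Fin n) : dy j (ex k) = 0 := by
  simp [dy, ex]

@[simp] lemma dy_ey (j k : Fin n) : dy j (ey k) = if j = k then 1 else 0 := by
  simp [dy, ey]

@[simp] lemma dy_ez (j : Fin n) : dy j (ez : RSpace n) = 0 := by
  simp [dy, ez]

@[simp] lemma dz_ex (k : Fin n) : dz (ex k) = 0 := by
  simp [dz, ex]

@[simp] lemma dz_ey (k : Fin n) : dz (ey k) = 0 := by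
  simp [dz, ey]

@[simp] lemma dz_ez : dz (ez : RSpace n) = 1 := by
  simp [dz, ez]

/-- The constant bilinear form `∑ dy_k ⊗ dx_k`. -/
def beta : RSpace n →L[ℝ] RSpace n →L[ℝ] ℝ := ∑ k, (dy k).smulRight (dx k)

lemma beta_apply (v w : RSpace n) : beta v w = ∑ k, dy k v * dx k w := by
  simp [beta]

@[simp] lemma beta_ez_left (w : RSpace n) : beta ez w = 0 := by simp [beta_apply]

@[simp] lemma beta_ez_right (w : RSpace n) : beta w ez = 0 := by simp [beta_apply]

lemma eta_eq : (eta : RSpace n → RSpace n →L[ℝ] ℝ) = fun p => dz - beta p := by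
  funext p
  ext v
  simp [eta, beta_apply]

lemma eta_apply (p v : RSpace n) : eta p v = dz v - beta p v := by
  simp [eta_eq]

@[simp] lemma eta_ez (p : RSpace n) : eta p ez = 1 := by simp [eta_apply]

lemma hasFDerivAt_eta (p : RSpace n) : HasFDerivAt eta (-beta : RSpace n →L[ℝ] _) p := by
  rw [eta_eq]
  exact beta.hasFDerivAt.const_sub _

lemma contDiff_eta : ContDiff ℝ ∞ (eta : RSpace n → RSpace n →L[ℝ] ℝ) := by
  rw [eta_eq]
  fun_prop

lemma dEta_eq (p v w : RSpace n) : dEta p v w = 1 / 2 * (beta w v - beta v w) := by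
  simp only [dEta, extD, (hasFDerivAt_eta p).fderiv, neg_apply]
  ring

/-- The forms `dx_k`, `dy_k`, `η` are a coframe. Using `η` in place of `dz` suits `φ`, whose image
lies in `ker η`. -/
lemma ext_of_forms (p : RSpace n) {v w : RSpace n} (hx : ∀ k, dx k v = dx k w)
    (hy : ∀ k, dy k v = dy k w) (he : eta p v = eta p w) : v = w := by
  have hz : dz v = dz w := by
    simp only [eta_apply, beta_apply, hx] at he
    linarith
  ext i
  rcases i with k | k | k
  · exact hx k
  · exact hy k
  · exact hz

lemma metric_comm (p v w : RSpace n) : metric p v w = metric p w v := by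
  simp only [metric, mul_comm]

lemma eq_zero_of_sum_sq {v : RSpace n}
    (h : ∑ k, (dx k v * dx k v + dy k v * dy k v) = 0) : (∀ k, dx k v = 0) ∧ ∀ k, dy k v = 0 := by
  rw [Finset.sum_eq_zero_iff_of_nonneg
    fun k _ => add_nonneg (mul_self_nonneg _) (mul_self_nonneg _)] at h
  constructor <;> intro k <;> have hk := h k (Finset.mem_univ k) <;>
    nlinarith [mul_self_nonneg (dx k v), mul_self_nonneg (dy k v)]

lemma eq_zero_of_metric_self {p v : RSpace n} (h : metric p v v = 0) : v = 0 := by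
  have h0 : 0 ≤ ∑ k, (dx k v * dx k v + dy k v * dy k v) :=
    Finset.sum_nonneg fun k _ => add_nonneg (mul_self_nonneg _) (mul_self_nonneg _)
  have h1 : ∑ k, (dx k v * dx k v + dy k v * dy k v) = 0 := by
    simp only [metric] at h
    nlinarith [mul_self_nonneg (eta p v)]
  have he : eta p v = 0 := by
    simp only [metric, h1] at h
    nlinarith
  obtain ⟨hx, hy⟩ := eq_zero_of_sum_sq h1
  exact ext_of_forms p (by simpa using hx) (by simpa using hy) (by simpa using he)

/-! ### The tensor field `φ` -/

lemma phi_eq (p v : RSpace n) :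
    phi p v = ∑ k, (dy k v • (ex k + dy k p • ez) - dx k v • ey k) := by
  simp [phi]

@[simp] lemma dx_phi (p v : RSpace n) (j : Fin n) : dx j (phi p v) = dy j v := by
  simp [phi_eq, map_sum]

@[simp] lemma dy_phi (p v : RSpace n) (j : Fin n) : dy j (phi p v) = -dx j v := by
  simp [phi_eq, map_sum]

@[simp] lemma eta_phi (p v : RSpace n) : eta p (phi p v) = 0 := by
  rw [eta_apply, beta_apply]
  simp [phi_eq p v, map_sum]
  simp [mul_comm]

lemma phi_phi {p v : RSpace n} (h : eta p v = 0) : phi p (phi p v) = -v :=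
  ext_of_forms p (by simp) (by simp) (by simp [h])

lemma dEta_phi_phi (p v w : RSpace n) : dEta p (phi p v) (phi p w) = dEta p v w := by
  simp only [dEta_eq, beta_apply, dx_phi, dy_phi, ← Finset.sum_sub_distrib]
  congr 1
  exact Finset.sum_congr rfl fun k _ => by ring

/-- Positivity of this expression on `ker η` is what makes a Legendrian subspace transversal to its
image under `φ`. -/
lemma dEta_phi_self (p v : RSpace n) :
    dEta p (phi p v) v = 1 / 2 * ∑ k, (dx k v * dx k v + dy k v * dy k v) := by
  simp only [dEta_eq, beta_apply, dx_phi, dy_phi, ← Finset.sum_sub_distrib]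
  congr 1
  exact Finset.sum_congr rfl fun k _ => by ring

lemma dEta_comm (p v w : RSpace n) : dEta p v w = -dEta p w v := by
  simp only [dEta_eq]
  ring

@[simp] lemma dEta_ez (p v : RSpace n) : dEta p v ez = 0 := by simp [dEta_eq]

lemma contDiff_phi : ContDiff ℝ ∞ (phi : RSpace n → RSpace n →L[ℝ] RSpace n) := by
  unfold phi
  refine ContDiff.sum fun k _ => ContDiff.sub ?_ contDiff_const
  exact contDiff_const.smulRight (by fun_prop)

/-- The coefficients of `φ` involve only the `y_k`, so the Reeb flow preserves `φ`. -/
lemma fderiv_phi_ez (p : RSpace n) : fderiv ℝ phi p ez = 0 := by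
  have h : HasLineDerivAt ℝ (phi : RSpace n → RSpace n →L[ℝ] RSpace n) 0 p ez := by
    have : (fun t : ℝ => phi (p + t • (ez : RSpace n))) = fun _ => phi p := by
      funext t
      simp [phi]
    rw [HasLineDerivAt, this]
    exact hasDerivAt_const _ _
  exact ((contDiff_phi.differentiable (by simp) p).lineDeriv_eq_fderiv).symm.trans h.lineDeriv

/-! ### Legendrian subspaces of the tangent spaces -/

/-- Legendrian subspaces of the tangent space at `p`. -/
structure IsLegendrianSubspace (p : RSpace n) (S : Submodule ℝ (RSpace n)) : Prop where
  finrank_eq : Module.finrank ℝ S = n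
  contact : ∀ v ∈ S, eta p v = 0
  isotropic : ∀ v ∈ S, ∀ w ∈ S, dEta p v w = 0

lemma IsLegendrianDistribution.isLegendrianSubspace {L : RSpace n → Submodule ℝ (RSpace n)}
    (hL : IsLegendrianDistribution L) (p : RSpace n) : IsLegendrianSubspace p (L p) where
  finrank_eq := by
    obtain ⟨U, -, hpU, X, -, hX⟩ := hL.subbundle p
    rw [← (hX p hpU).2, finrank_span_eq_card (hX p hpU).1, Fintype.card_fin]
  contact := hL.contact p
  isotropic := hL.isotropic p

namespace IsLegendrianSubspace

variable {p : RSpace n} {S : Submodule ℝ (RSpace n)}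

lemma map_phi (hS : IsLegendrianSubspace p S) :
    IsLegendrianSubspace p (S.map (phi p).toLinearMap) where
  finrank_eq := by
    have hinj : Function.Injective ((phi p).toLinearMap.domRestrict S) := by
      rw [injective_iff_map_eq_zero]
      rintro ⟨v, hv⟩ h
      have h0 : phi p v = 0 := h
      have h1 := phi_phi (hS.contact v hv)
      rw [h0, map_zero] at h1
      exact Subtype.ext (neg_eq_zero.1 h1.symm)
    have h := LinearMap.finrank_range_of_inj hinj
    rw [LinearMap.range_domRestrict] at h
    exact h.trans hS.finrank_eq
  contact := by
    rintro _ ⟨v, -, rfl⟩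
    exact eta_phi p v
  isotropic := by
    rintro _ ⟨v, hv, rfl⟩ _ ⟨w, hw, rfl⟩
    exact (dEta_phi_phi p v w).trans (hS.isotropic v hv w hw)

lemma map_phi_map_phi (hS : IsLegendrianSubspace p S) :
    (S.map (phi p).toLinearMap).map (phi p).toLinearMap = S := by
  ext v
  constructor
  · rintro ⟨_, ⟨w, hw, rfl⟩, rfl⟩
    have : phi p (phi p w) ∈ S := by
      rw [phi_phi (hS.contact w hw)]
      exact S.neg_mem hw
    exact this
  · intro hv
    refine ⟨_, ⟨-v, S.neg_mem hv, rfl⟩, ?_⟩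
    have := phi_phi (p := p) (v := -v) (by simp [hS.contact v hv])
    simpa using this

lemma disjoint (hS : IsLegendrianSubspace p S) :
    Disjoint S (S.map (phi p).toLinearMap ⊔ reebLine p) := by
  rw [Submodule.disjoint_def]
  intro v hv hv'
  obtain ⟨_, ⟨x, hx, rfl⟩, _, hz, rfl⟩ := Submodule.mem_sup.1 hv'
  obtain ⟨c, rfl⟩ := Submodule.mem_span_singleton.1 hz
  have hc : c = 0 := by
    simpa [xi] using hS.contact _ hv
  subst hc
  -- Both `x` and `φ x` now lie in the isotropic `S`, so `dEta_phi_self` forces `x = 0`.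
  have h : phi p x ∈ S := by simpa using hv
  have h0 := hS.isotropic _ h _ hx
  rw [dEta_phi_self] at h0
  obtain ⟨h1, h2⟩ := eq_zero_of_sum_sq (v := x) (by linarith)
  have : x = 0 := ext_of_forms p (by simpa using h1) (by simpa using h2) (by simp [hS.contact x hx])
  simp [this]

/-- Disjointness suffices, by the dimension count `n + (n + 1) = 2n + 1`. -/
lemma isCompl (hS : IsLegendrianSubspace p S) :
    IsCompl S (S.map (phi p).toLinearMap ⊔ reebLine p) := by
  refine (Submodule.isCompl_iff_disjoint _ _ ?_).2 hS.disjoint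
  have hinf : S.map (phi p).toLinearMap ⊓ reebLine p = ⊥ := by
    rw [eq_bot_iff]
    rintro _ ⟨hv, hv'⟩
    obtain ⟨c, rfl⟩ := Submodule.mem_span_singleton.1 hv'
    have hc : c = 0 := by simpa [xi] using hS.map_phi.contact _ hv
    simp [hc]
  have hreeb : Module.finrank ℝ (reebLine p) = 1 := by
    refine finrank_span_singleton fun h => ?_
    simpa [xi] using congrArg (eta p) h
  have hsum := Submodule.finrank_sup_add_finrank_inf_eq (S.map (phi p).toLinearMap) (reebLine p)
  rw [hinf, finrank_bot, hS.map_phi.finrank_eq, hreeb] at hsum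
  rw [hS.finrank_eq, finrank_euclideanSpace]
  simp only [Fintype.card_sum, Fintype.card_fin, Fintype.card_unit]
  omega

lemma isCompl' (hS : IsLegendrianSubspace p S) :
    IsCompl (S.map (phi p).toLinearMap) (S ⊔ reebLine p) := by
  have := hS.map_phi.isCompl
  rwa [hS.map_phi_map_phi] at this

/-- Legendrian subspaces are maximal isotropic in `ker η`. -/
lemma mem_of_dEta_eq_zero (hS : IsLegendrianSubspace p S) {v : RSpace n} (hv : eta p v = 0)
    (h : ∀ w ∈ S, dEta p v w = 0) : v ∈ S := by
  have hv' : v ∈ S ⊔ (S.map (phi p).toLinearMap ⊔ reebLine p) := by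
    rw [hS.isCompl.sup_eq_top]; trivial
  obtain ⟨x, hx, _, hyz, rfl⟩ := Submodule.mem_sup.1 hv'
  obtain ⟨_, ⟨y, hy, rfl⟩, _, hz, rfl⟩ := Submodule.mem_sup.1 hyz
  obtain ⟨c, rfl⟩ := Submodule.mem_span_singleton.1 hz
  have hc : c = 0 := by
    simpa [xi, hS.contact x hx] using hv
  subst hc
  -- The vector is `x + φ y`; testing against `y` itself leaves only `dη(φ y, y)`, which is
  -- definite.
  have h0 := h y hy
  have h1 := hS.isotropic x hx y hy
  have h2 := dEta_phi_self p y
  simp only [dEta_eq, zero_smul, add_zero, map_add, add_apply,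
    ContinuousLinearMap.coe_coe] at h0 h1 h2
  obtain ⟨h3, h4⟩ := eq_zero_of_sum_sq (v := y) (by linarith)
  have : y = 0 := ext_of_forms p (by simpa using h3) (by simpa using h4) (by simp [hS.contact y hy])
  simpa [this] using hx

end IsLegendrianSubspace

/-! ### Sections of Legendrian distributions -/

lemma IsSmoothField.differentiable {V : RSpace n → RSpace n} (hV : IsSmoothField V) :
    Differentiable ℝ V :=
  ContDiff.differentiable hV (by simp)

lemma IsSmoothField.differentiable_fderiv {V : RSpace n → RSpace n} (hV : IsSmoothField V) :
    Differentiable ℝ (fderiv ℝ V) :=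
  (ContDiff.fderiv_right (m := 1) hV (by norm_cast)).differentiable (by simp)

/-- Every vector of a smooth subbundle is the value of a global section. -/
lemma IsSubbundle.exists_section {r : ℕ} {L : RSpace n → Submodule ℝ (RSpace n)}
    (hL : IsSubbundle r L) {p x : RSpace n} (hx : x ∈ L p) : ∃ X, IsSection L X ∧ X p = x := by
  obtain ⟨U, hU, hpU, X, hX, hspan⟩ := hL p
  -- A bump function supported in the frame's domain extends a local section by zero.
  obtain ⟨f, hf, -, hfs, -, hfp⟩ := exists_contDiff_tsupport_subset (n := (⊤ : ℕ∞))
    (hU.mem_nhds hpU)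
  rw [← (hspan p hpU).2] at hx
  obtain ⟨c, rfl⟩ := (Submodule.mem_span_range_iff_exists_fun ℝ).1 hx
  refine ⟨fun q => f q • ∑ i, c i • X i q, ⟨?_, ?_⟩, by simp [hfp]⟩
  · refine contDiff_iff_contDiffAt.2 fun q => ?_
    by_cases hq : q ∈ tsupport f
    · have hq' : U ∈ 𝓝 q := hU.mem_nhds (hf hq)
      exact hfs.contDiffAt.smul
        (ContDiffAt.sum fun i _ => ((hX i).contDiffAt hq').const_smul (c i))
    · refine (contDiffAt_const (c := (0 : RSpace n))).congr_of_eventuallyEq ?_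
      filter_upwards [notMem_tsupport_iff_eventuallyEq.1 hq] with y hy
      simp [hy]
  · intro q
    by_cases hq : q ∈ tsupport f
    · rw [← (hspan q (hf hq)).2]
      exact Submodule.smul_mem _ _ (Submodule.sum_mem _ fun i _ =>
        Submodule.smul_mem _ _ (Submodule.subset_span ⟨i, rfl⟩))
    · simp [image_eq_zero_of_notMem_tsupport hq]

lemma IsSection.phi {L : RSpace n → Submodule ℝ (RSpace n)} {X : RSpace n → RSpace n}
    (hX : IsSection L X) : IsSection (conjugate L) fun p => phi p (X p) :=
  ⟨contDiff_phi.clm_apply hX.1, fun p => ⟨X p, hX.2 p, rfl⟩⟩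

namespace IsLegendrianDistribution

variable {L : RSpace n → Submodule ℝ (RSpace n)}

lemma exists_section_conjugate (hL : IsLegendrianDistribution L) {p y : RSpace n}
    (hy : y ∈ conjugate L p) : ∃ Y, IsSection (conjugate L) Y ∧ Y p = y := by
  obtain ⟨x, hx, rfl⟩ := hy
  obtain ⟨X, hX, rfl⟩ := hL.subbundle.exists_section hx
  exact ⟨_, hX.phi, rfl⟩

lemma isLegendrianSubspace_conjugate (hL : IsLegendrianDistribution L) (p : RSpace n) :
    IsLegendrianSubspace p (conjugate L p) :=
  (hL.isLegendrianSubspace p).map_phi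

lemma isCompl (hL : IsLegendrianDistribution L) (p : RSpace n) :
    IsCompl (L p) (conjugate L p ⊔ reebLine p) :=
  (hL.isLegendrianSubspace p).isCompl

lemma isCompl' (hL : IsLegendrianDistribution L) (p : RSpace n) :
    IsCompl (conjugate L p) (L p ⊔ reebLine p) :=
  (hL.isLegendrianSubspace p).isCompl'

/-- Every section of the conjugate distribution is the image under `φ` of a section. -/
lemma exists_section_phi_eq (hL : IsLegendrianDistribution L) {Y : RSpace n → RSpace n}
    (hY : IsSection (conjugate L) Y) : ∃ X, IsSection L X ∧ Y = fun p => phi p (X p) := by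
  -- On `ker η` the inverse of `φ` is `-φ`.
  refine ⟨fun p => phi p (-Y p), ⟨contDiff_phi.clm_apply hY.1.neg, fun p => ?_⟩, ?_⟩
  · rw [← (hL.isLegendrianSubspace p).map_phi_map_phi]
    exact ⟨-Y p, Submodule.neg_mem _ (hY.2 p), rfl⟩
  · funext p
    rw [phi_phi, neg_neg]
    simp [(hL.isLegendrianSubspace_conjugate p).contact _ (hY.2 p)]

end IsLegendrianDistribution

/-! ### Reeb invariance of flat Legendrian foliations -/

lemma lieBracket_xi (X : RSpace n → RSpace n) (p : RSpace n) :
    lieBracket ℝ xi X p = fderiv ℝ X p ez := by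
  have : (xi : RSpace n → RSpace n) = fun _ => ez := rfl
  simp [lieBracket_eq, this]

lemma lieBracket_xi_phi {X : RSpace n → RSpace n} (hX : IsSmoothField X) (p : RSpace n) :
    lieBracket ℝ xi (fun q => phi q (X q)) p = phi p (lieBracket ℝ xi X p) := by
  rw [lieBracket_xi, lieBracket_xi, fderiv_clm_apply (contDiff_phi.differentiable (by simp) p)
    (hX.differentiable p)]
  simp [fderiv_phi_ez]

/-- The derivative of the identity `η(X) = 0`. -/
lemma eta_fderiv {X : RSpace n → RSpace n} (hX : IsSmoothField X) (h : ∀ p, eta p (X p) = 0)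
    (p v : RSpace n) : eta p (fderiv ℝ X p v) = beta v (X p) := by
  have h1 : fderiv ℝ (fun q => eta q (X q)) p v = 0 := by simp [h]
  rw [fderiv_clm_apply (contDiff_eta.differentiable (by simp) p) (hX.differentiable p),
    (hasFDerivAt_eta p).fderiv] at h1
  simp at h1
  linarith

/-- Cartan's formula with `η(X) = 0`; the factor 2 comes from the normalization of `dη`. -/
lemma lieDeriv_eta {X : RSpace n → RSpace n} (hX : IsSmoothField X) (h : ∀ p, eta p (X p) = 0)
    (p v : RSpace n) : lieDeriv X eta p v = 2 * dEta p (X p) v := by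
  simp [lieDeriv, (hasFDerivAt_eta p).fderiv, eta_fderiv hX h, dEta_eq]
  ring

/-- Flatness thereby says that `[ξ, X]` is `dη`-orthogonal to `L`, hence in `L` by maximal isotropy.
-/
lemma pangForm_eq {X X' : RSpace n → RSpace n} (hX' : IsSmoothField X')
    (h : ∀ p, eta p (X' p) = 0) (p : RSpace n) :
    pangForm X X' p = 2 * dEta p (lieBracket ℝ xi X p) (X' p) := by
  have hd : DifferentiableAt ℝ (lieDeriv X' eta) p := by
    have h1 : (lieDeriv X' eta : RSpace n → RSpace n →L[ℝ] ℝ)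
        = fun q => -beta (X' q) + (eta q).comp (fderiv ℝ X' q) := by
      funext q
      simp [lieDeriv, (hasFDerivAt_eta q).fderiv]
    rw [h1]
    exact ((beta.differentiableAt.comp p (hX'.differentiable p)).neg).add
      ((contDiff_eta.differentiable (by simp) p).clm_comp (hX'.differentiable_fderiv p))
  -- The form `𝓛_{X'} η` vanishes on `ξ` everywhere, so only the term with the derivative of `X`
  -- survives.
  have h0 : fderiv ℝ (fun q => lieDeriv X' eta q (ez : RSpace n)) p (X p) = 0 := by
    simp [lieDeriv_eta hX' h]
  rw [fderiv_clm_apply hd (differentiableAt_const _)] at h0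
  have h2 : fderiv ℝ (lieDeriv X' eta) p (X p) (ez : RSpace n) = 0 := by simpa using h0
  have h3 := lieDeriv_eta hX' h p (fderiv ℝ X p ez)
  rw [pangForm, lieDeriv, lieBracket_xi, dEta_comm]
  simp only [xi, add_apply, ContinuousLinearMap.comp_apply, h2, h3]
  ring

/-- The tangent bundle of a flat Legendrian foliation is invariant under the Reeb flow. -/
lemma IsFlatFoliation.lieBracket_xi_mem {L : RSpace n → Submodule ℝ (RSpace n)}
    (hflat : IsFlatFoliation L) (hL : IsLegendrianDistribution L) {X : RSpace n → RSpace n}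
    (hX : IsSection L X) (p : RSpace n) : lieBracket ℝ xi X p ∈ L p := by
  refine (hL.isLegendrianSubspace p).mem_of_dEta_eq_zero ?_ fun w hw => ?_
  · rw [lieBracket_xi, eta_fderiv hX.1 fun q => hL.contact q _ (hX.2 q)]
    simp
  · obtain ⟨X', hX', rfl⟩ := hL.subbundle.exists_section hw
    have h := hflat X X' hX hX' p
    rw [pangForm_eq hX'.1 fun q => hL.contact q _ (hX'.2 q)] at h
    linarith

lemma IsFlatFoliation.lieBracket_xi_mem_conjugate {L : RSpace n → Submodule ℝ (RSpace n)}
    (hflat : IsFlatFoliation L) (hL : IsLegendrianDistribution L) {Y : RSpace n → RSpace n}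
    (hY : IsSection (conjugate L) Y) (p : RSpace n) :
    lieBracket ℝ xi Y p ∈ conjugate L p := by
  obtain ⟨X, hX, rfl⟩ := hL.exists_section_phi_eq hY
  rw [lieBracket_xi_phi hX.1]
  exact ⟨_, hflat.lieBracket_xi_mem hL hX p, rfl⟩

lemma component_of_mem_left {A B : RSpace n → Submodule ℝ (RSpace n)} {V : RSpace n → RSpace n}
    {p : RSpace n} (h : IsCompl (A p) (B p ⊔ reebLine p)) (hV : V p ∈ A p) :
    component A B V p = V p := by
  rw [component, dif_pos h]
  exact Submodule.projection_apply_left h ⟨V p, hV⟩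

lemma component_of_mem_right {A B : RSpace n → Submodule ℝ (RSpace n)} {V : RSpace n → RSpace n}
    {p : RSpace n} (h : IsCompl (A p) (B p ⊔ reebLine p)) (hV : V p ∈ B p) :
    component A B V p = 0 := by
  rw [component, dif_pos h]
  exact (Submodule.projection_apply_eq_zero_iff h).2 (Submodule.mem_sup_left hV)

/-! ### The difference tensor of a connection -/

/-- The covariant derivative of the vector field `W`, as a field of endomorphisms of
`ℝ^{2n+1}`. -/
def cov (D : Connection n) (W : RSpace n → RSpace n) (p : RSpace n) : RSpace n →L[ℝ] RSpace n :=
  D W p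

lemma nabla_eq (D : Connection n) (V W : RSpace n → RSpace n) (p : RSpace n) :
    nabla D V W p = cov D W p (V p) := rfl

/-- The derivative of the constant field with value the `i`-th basis vector. -/
def coordDeriv (D : Connection n) (i : Fin n ⊕ Fin n ⊕ Unit) (p : RSpace n) :
    RSpace n →L[ℝ] RSpace n :=
  cov D (fun _ => EuclideanSpace.single i 1) p

/-- The difference of a connection and the connection for which the vector fields
`∂/∂x_k + y_k ∂/∂z`, `∂/∂y_k` and `∂/∂z` are parallel. -/
def diffTensor (D : Connection n) (p : RSpace n) : RSpace n →ₗ[ℝ] RSpace n →ₗ[ℝ] RSpace n :=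
  LinearMap.mk₂ ℝ (fun v w => ∑ i, w i • coordDeriv D i p v + beta v w • ez)
    (by
      intro v v' w
      simp only [map_add, smul_add, Finset.sum_add_distrib, add_apply, add_smul]
      abel)
    (by
      intro c v w
      simp only [map_smul, smul_apply, smul_eq_mul, smul_add, Finset.smul_sum, mul_smul]
      simp only [smul_comm c])
    (by
      intro v w w'
      simp only [map_add, PiLp.add_apply, Finset.sum_add_distrib, add_smul]
      abel)
    (by
      intro c v w
      simp only [map_smul, smul_eq_mul, PiLp.smul_apply, smul_add, Finset.smul_sum, mul_smul])

lemma IsSmoothField.mdifferentiableAt {W : RSpace n → RSpace n} (hW : IsSmoothField W)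
    (p : RSpace n) :
    MDifferentiableAt 𝓘(ℝ, RSpace n) (𝓘(ℝ, RSpace n).prod 𝓘(ℝ, RSpace n))
      (fun q => (⟨q, W q⟩ : TangentBundle 𝓘(ℝ, RSpace n) (RSpace n))) p :=
  (contMDiffAt_vectorSpace_iff_contDiffAt.2 (ContDiff.contDiffAt hW)).mdifferentiableAt (by simp)

lemma cov_add (D : Connection n) {V W : RSpace n → RSpace n} (hV : IsSmoothField V)
    (hW : IsSmoothField W) (p v : RSpace n) :
    cov D (V + W) p v = cov D V p v + cov D W p v :=
  congrArg (fun T : RSpace n →L[ℝ] RSpace n => T v)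
    (D.isCovariantDerivativeOnUniv.add (hV.mdifferentiableAt p) (hW.mdifferentiableAt p))

lemma cov_smul (D : Connection n) {f : RSpace n → ℝ} {W : RSpace n → RSpace n}
    (hf : ContDiff ℝ ∞ f) (hW : IsSmoothField W) (p v : RSpace n) :
    cov D (fun q => f q • W q) p v
      = f p • cov D W p v + fderiv ℝ f p v • W p := by
  have hf' := hf.differentiable (by simp) p
  have h := congrArg (fun T : RSpace n →L[ℝ] RSpace n => T v)
    (D.isCovariantDerivativeOnUniv.leibniz (hW.mdifferentiableAt p) hf'.mdifferentiableAt)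
  refine h.trans ?_
  have h2 : mvfderiv 𝓘(ℝ, RSpace n) f p v = fderiv ℝ f p v := by
    simp [mvfderiv, mfderiv_eq_fderiv]
    rfl
  exact congrArg (fun c : ℝ => f p • cov D W p v + c • W p) h2

lemma cov_sum (D : Connection n) {ι : Type*} (s : Finset ι)
    {f : ι → RSpace n → RSpace n} (hf : ∀ i, IsSmoothField (f i)) (p v : RSpace n) :
    cov D (fun q => ∑ i ∈ s, f i q) p v = ∑ i ∈ s, cov D (f i) p v := by
  classical
  induction s using Finset.induction_on with
  | empty =>
    simp only [Finset.sum_empty]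
    exact congrArg (fun T : RSpace n →L[ℝ] RSpace n => T v)
      (D.isCovariantDerivativeOnUniv.zero (x := p))
  | insert a s ha ih =>
    have h1 : (fun q => ∑ i ∈ insert a s, f i q) = f a + fun q => ∑ i ∈ s, f i q := by
      funext q
      simp [Finset.sum_insert ha]
    rw [h1, cov_add D (hf a) (ContDiff.sum fun i _ => hf i), ih, Finset.sum_insert ha]

lemma sum_coord_smul_single (w : RSpace n) :
    ∑ i, w i • (EuclideanSpace.single i (1 : ℝ) : RSpace n) = w := by
  ext j
  simp only [PiLp.smul_apply, smul_eq_mul, EuclideanSpace.single, PiLp.single_apply,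
    WithLp.ofLp_sum, Finset.sum_apply]
  simp [-Fintype.sum_sum_type]

/-- A connection, as the sum of a reference connection and the difference tensor. -/
lemma cov_eq (D : Connection n) {W : RSpace n → RSpace n} (hW : IsSmoothField W)
    (p v : RSpace n) :
    cov D W p v
      = fderiv ℝ W p v - beta v (W p) • ez + diffTensor D p v (W p) := by
  have hcoord (i : Fin n ⊕ Fin n ⊕ Unit) : ContDiff ℝ ∞ fun q => W q i :=
    (EuclideanSpace.proj (𝕜 := ℝ) i).contDiff.comp hW
  have hfd (i : Fin n ⊕ Fin n ⊕ Unit) : fderiv ℝ (fun q => W q i) p v = fderiv ℝ W p v i := by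
    have := ((EuclideanSpace.proj (𝕜 := ℝ) i).hasFDerivAt.comp p
      (hW.differentiable p).hasFDerivAt).fderiv
    exact congrArg (fun T : RSpace n →L[ℝ] ℝ => T v) this
  -- Expanding in the constant basis and applying the Leibniz rule separates the derivative of `W`
  -- from a term tensorial in `W`.
  have h1 : W = fun q => ∑ i, W q i • (EuclideanSpace.single i (1 : ℝ) : RSpace n) := by
    funext q
    exact (sum_coord_smul_single _).symm
  conv_lhs => rw [h1]
  rw [cov_sum D Finset.univ (f := fun i q => W q i • EuclideanSpace.single i (1 : ℝ))
    fun i => (hcoord i).smul contDiff_const]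
  simp_rw [cov_smul D (hcoord _) contDiff_const, Finset.sum_add_distrib, hfd,
    sum_coord_smul_single]
  simp only [diffTensor, LinearMap.mk₂_apply, coordDeriv]
  abel

/-! ### The adapted fields and the consequences of parallelism -/

/-- The vector field with constant coefficients in the frame `∂/∂x_k + y_k ∂/∂z`, `∂/∂y_k`,
`∂/∂z` and with value `w` at `p`. -/
def adapted (p w : RSpace n) : RSpace n → RSpace n := fun q => w + beta (q - p) w • ez

lemma adapted_self (p w : RSpace n) : adapted p w p = w := by simp [adapted]

lemma isSmoothField_adapted (p w : RSpace n) : IsSmoothField (adapted p w) := by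
  unfold IsSmoothField adapted
  fun_prop

lemma fderiv_adapted (p w v : RSpace n) : fderiv ℝ (adapted p w) p v = beta v w • ez := by
  have h : HasFDerivAt (adapted p w) ((beta.flip w).smulRight (ez : RSpace n)) p := by
    have h1 : HasFDerivAt (fun q => beta (q - p) w) (beta.flip w) p :=
      (beta.flip w).hasFDerivAt.comp p ((hasFDerivAt_id p).sub_const p)
    exact (h1.smul_const _).const_add w
  simp [h.fderiv]

lemma cov_adapted (D : Connection n) (p w v : RSpace n) :
    cov D (adapted p w) p v = diffTensor D p v w := by
  rw [cov_eq D (isSmoothField_adapted p w), fderiv_adapted, adapted_self, sub_self, zero_add]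

/-- The correction along `ez` cancels the variation of `η`, so `dx_k`, `dy_k` and `η` are all
constant on adapted fields. -/
lemma metric_adapted (p w u q : RSpace n) :
    metric q (adapted p w q) (adapted p u q) = metric p w u := by
  have h (w : RSpace n) : eta q (adapted p w q) = eta p w := by
    simp [adapted, eta_apply]
    ring
  simp only [metric, h]
  simp [adapted]

lemma dEta_adapted (p w u q : RSpace n) :
    dEta q (adapted p w q) (adapted p u q) = dEta p w u := by
  simp [dEta_eq, adapted]

/-- A field of bilinear forms that is constant in the adapted frame is parallel only if the
difference tensor is skew with respect to it. -/
lemma IsParallel.diffTensor {D : Connection n} {B : RSpace n → RSpace n → RSpace n → ℝ}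
    (h : IsParallel D B)
    (hB : ∀ p w u q, B q (adapted p w q) (adapted p u q) = B p w u) (p v w u : RSpace n) :
    B p (diffTensor D p v w) u + B p w (diffTensor D p v u) = 0 := by
  have h1 := h (fun _ => v) (adapted p w) (adapted p u) contDiff_const
    (isSmoothField_adapted p w) (isSmoothField_adapted p u) p
  simp only [hB, nabla_eq, cov_adapted D, adapted_self] at h1
  simpa using h1.symm

/-- The last term is the torsion of the reference connection, so torsion conditions become symmetry
conditions on the difference tensor. -/
lemma torsionField_eq (D : Connection n) {V W : RSpace n → RSpace n} (hV : IsSmoothField V)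
    (hW : IsSmoothField W) (p : RSpace n) :
    torsionField D V W p = diffTensor D p (V p) (W p) - diffTensor D p (W p) (V p)
      + (2 * dEta p (V p) (W p)) • xi p := by
  simp only [torsionField, nabla_eq, cov_eq D hV, cov_eq D hW, lieBracket_eq, dEta_eq, xi]
  module

/-! ### Symmetry of the difference tensor -/

section Symmetry

variable {L : RSpace n → Submodule ℝ (RSpace n)} {D : Connection n}

lemma IsBiLegendrianConnection.diffTensor_comm_mixed
    (hD : IsBiLegendrianConnection L (conjugate L) D) (hL : IsLegendrianDistribution L)
    {p x y : RSpace n} (hx : x ∈ L p) (hy : y ∈ conjugate L p) :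
    diffTensor D p x y = diffTensor D p y x := by
  obtain ⟨X, hX, rfl⟩ := hL.subbundle.exists_section hx
  obtain ⟨Y, hY, rfl⟩ := hL.exists_section_conjugate hy
  have h := hD.torsion_mixed X Y hX hY p
  rw [torsionField_eq D hX.1 hY.1] at h
  exact sub_eq_zero.1 (add_eq_right.1 h)

lemma diffTensor_comm_xi_of_torsionField {V : RSpace n → RSpace n} (hV : IsSmoothField V)
    {p : RSpace n} (h : torsionField D V xi p = 0) :
    diffTensor D p (V p) ez = diffTensor D p ez (V p) := by
  rw [torsionField_eq D hV (W := xi) contDiff_const] at h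
  simp only [xi, dEta_ez, mul_zero, zero_smul, add_zero] at h
  exact sub_eq_zero.1 h

lemma lieBracket_xi_zero (p : RSpace n) :
    lieBracket ℝ xi (fun _ => (0 : RSpace n)) p = 0 := by
  simp [lieBracket_xi]

/-- By flatness `[ξ, X]` stays in `L` and has no `Q`-component, so `T(X, ξ) = 0`. -/
lemma IsBiLegendrianConnection.diffTensor_comm_xi_left
    (hD : IsBiLegendrianConnection L (conjugate L) D) (hL : IsLegendrianDistribution L)
    (hflat : IsFlatFoliation L) {p x : RSpace n} (hx : x ∈ L p) :
    diffTensor D p x ez = diffTensor D p ez x := by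
  obtain ⟨X, hX, rfl⟩ := hL.subbundle.exists_section hx
  refine diffTensor_comm_xi_of_torsionField hX.1 ?_
  have h1 : component L (conjugate L) X = X :=
    funext fun q => component_of_mem_left (hL.isCompl q) (hX.2 q)
  have h2 : component (conjugate L) L X = fun _ => 0 :=
    funext fun q => component_of_mem_right (hL.isCompl' q) (hX.2 q)
  rw [hD.torsion_reeb X hX.1, h1, h2,
    component_of_mem_right (hL.isCompl' p) (hflat.lieBracket_xi_mem hL hX p),
    component_of_mem_left (hL.isCompl p) (by simp [lieBracket_xi_zero]), lieBracket_xi_zero,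
    add_zero]

lemma IsBiLegendrianConnection.diffTensor_comm_xi_right
    (hD : IsBiLegendrianConnection L (conjugate L) D) (hL : IsLegendrianDistribution L)
    (hflat : IsFlatFoliation L) {p y : RSpace n} (hy : y ∈ conjugate L p) :
    diffTensor D p y ez = diffTensor D p ez y := by
  obtain ⟨Y, hY, rfl⟩ := hL.exists_section_conjugate hy
  refine diffTensor_comm_xi_of_torsionField hY.1 ?_
  have h1 : component (conjugate L) L Y = Y :=
    funext fun q => component_of_mem_left (hL.isCompl' q) (hY.2 q)
  have h2 : component L (conjugate L) Y = fun _ => 0 :=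
    funext fun q => component_of_mem_right (hL.isCompl q) (hY.2 q)
  rw [hD.torsion_reeb Y hY.1, h1, h2,
    component_of_mem_right (hL.isCompl p) (hflat.lieBracket_xi_mem_conjugate hL hY p),
    component_of_mem_left (hL.isCompl' p) (by simp [lieBracket_xi_zero]), lieBracket_xi_zero,
    add_zero]

/-- If `P` is an integrable isotropic distribution preserved by `D`, then the torsion of `D` maps
`P × P` to `P`. -/
lemma Preserves.diffTensor_sub_mem {P : RSpace n → Submodule ℝ (RSpace n)} (hP : Preserves D P)
    (hint : IsIntegrable P) (hiso : ∀ p, ∀ v ∈ P p, ∀ w ∈ P p, dEta p v w = 0)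
    {X Y : RSpace n → RSpace n} (hX : IsSection P X) (hY : IsSection P Y) (p : RSpace n) :
    diffTensor D p (X p) (Y p) - diffTensor D p (Y p) (X p) ∈ P p := by
  have h := torsionField_eq D hX.1 hY.1 p
  rw [hiso p _ (hX.2 p) _ (hY.2 p), mul_zero, zero_smul, add_zero] at h
  rw [← h]
  exact sub_mem (sub_mem (hP X Y hX.1 hY p) (hP Y X hY.1 hX p)) ((hint X Y hX hY).2 p)

/-- A bilinear map that is skew for `dη`, symmetric on `S × φS`, and whose antisymmetrization maps
`S × S` to `S`, is symmetric on `S`. -/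
lemma IsLegendrianSubspace.comm_of_skew {p : RSpace n} {S : Submodule ℝ (RSpace n)}
    (hS : IsLegendrianSubspace p S) (A : RSpace n →ₗ[ℝ] RSpace n →ₗ[ℝ] RSpace n)
    (hA : ∀ v w u, dEta p (A v w) u + dEta p w (A v u) = 0)
    (hmix : ∀ x ∈ S, ∀ y ∈ S.map (phi p).toLinearMap, A x y = A y x)
    {x x' : RSpace n} (hx : x ∈ S) (hx' : x' ∈ S) (hmem : A x x' - A x' x ∈ S) :
    A x x' = A x' x := by
  rw [← sub_eq_zero]
  -- Pair with `y ∈ φS`: mixed symmetry turns `A x y`, `A x' y` into `A y x`, `A y x'`, and skewness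
  -- of `A y` cancels the result. Maximal isotropy of `φS` then applies.
  have key : A x x' - A x' x ∈ S.map (phi p).toLinearMap := by
    refine hS.map_phi.mem_of_dEta_eq_zero (hS.contact _ hmem) fun y hy => ?_
    have h1 := hA x x' y
    have h2 := hA x' x y
    have h3 := hA y x x'
    rw [hmix x hx y hy] at h1
    rw [hmix x' hx' y hy] at h2
    simp only [dEta_eq, map_sub, sub_apply] at h1 h2 h3 ⊢
    linarith
  exact (Submodule.disjoint_def.1 hS.disjoint) _ hmem (Submodule.mem_sup_left key)

lemma IsBiLegendrianConnection.diffTensor_comm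
    (hD : IsBiLegendrianConnection L (conjugate L) D) (hL : IsLegendrianFoliation L)
    (hflat : IsFlatFoliation L) (hQ : IsIntegrable (conjugate L)) (p v w : RSpace n) :
    diffTensor D p v w = diffTensor D p w v := by
  have hL' := hL.legendrian
  have hS := hL'.isLegendrianSubspace p
  have hskew := hD.parallel_dEta.diffTensor dEta_adapted p
  have hLL : ∀ x ∈ L p, ∀ x' ∈ L p, diffTensor D p x x' = diffTensor D p x' x := by
    intro x hx x' hx'
    refine hS.comm_of_skew _ hskew (fun x hx y hy => hD.diffTensor_comm_mixed hL' hx hy) hx hx' ?_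
    obtain ⟨X, hX, rfl⟩ := hL'.subbundle.exists_section hx
    obtain ⟨X', hX', rfl⟩ := hL'.subbundle.exists_section hx'
    exact hD.preserves_left.diffTensor_sub_mem hL.integrable hL'.isotropic hX hX' p
  have hQQ : ∀ y ∈ conjugate L p, ∀ y' ∈ conjugate L p,
      diffTensor D p y y' = diffTensor D p y' y := by
    intro y hy y' hy'
    -- The same argument with `L` and `Q` exchanged, since `φQ = L`.
    refine hS.map_phi.comm_of_skew _ hskew (fun y hy x hx => ?_) hy hy' ?_
    · rw [hS.map_phi_map_phi] at hx
      exact (hD.diffTensor_comm_mixed hL' hx hy).symm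
    · obtain ⟨Y, hY, rfl⟩ := hL'.exists_section_conjugate hy
      obtain ⟨Y', hY', rfl⟩ := hL'.exists_section_conjugate hy'
      exact hD.preserves_right.diffTensor_sub_mem hQ
        (fun q => (hL'.isLegendrianSubspace_conjugate q).isotropic) hY hY' p
  have hsplit (u : RSpace n) : ∃ x ∈ L p, ∃ y ∈ conjugate L p, ∃ c : ℝ, u = x + (y + c • ez) := by
    have hu : u ∈ L p ⊔ (conjugate L p ⊔ reebLine p) := by
      rw [(hL'.isCompl p).sup_eq_top]
      trivial
    obtain ⟨x, hx, _, hyz, rfl⟩ := Submodule.mem_sup.1 hu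
    obtain ⟨y, hy, _, hz, rfl⟩ := Submodule.mem_sup.1 hyz
    obtain ⟨c, rfl⟩ := Submodule.mem_span_singleton.1 hz
    exact ⟨x, hx, y, hy, c, rfl⟩
  obtain ⟨x, hx, y, hy, c, rfl⟩ := hsplit v
  obtain ⟨x', hx', y', hy', c', rfl⟩ := hsplit w
  simp only [map_add, map_smul, LinearMap.add_apply, LinearMap.smul_apply, hLL x hx x' hx',
    hQQ y hy y' hy', hD.diffTensor_comm_mixed hL' hx hy', hD.diffTensor_comm_mixed hL' hx' hy,
    hD.diffTensor_comm_xi_left hL' hflat hx, hD.diffTensor_comm_xi_left hL' hflat hx',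
    hD.diffTensor_comm_xi_right hL' hflat hy, hD.diffTensor_comm_xi_right hL' hflat hy']
  module

end Symmetry

/-! ### Metric rigidity and flatness -/

/-- A symmetric difference tensor of a metric connection vanishes. -/
lemma diffTensor_eq_zero {D : Connection n} (hg : IsParallel D metric)
    (hsymm : ∀ p v w, diffTensor D p v w = diffTensor D p w v) (p : RSpace n) :
    diffTensor D p = 0 := by
  have hskew := hg.diffTensor metric_adapted p
  ext1 v
  ext1 w
  refine eq_zero_of_metric_self (p := p) ?_
  have hskew' (a b c : RSpace n) :
      metric p (diffTensor D p a b) c + metric p (diffTensor D p a c) b = 0 := by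
    rw [metric_comm p (diffTensor D p a c)]
    exact hskew a b c
  generalize hu : diffTensor D p v w = u
  -- As in the Koszul formula, cycle skewness through `v, w, u`: with `a = g(A v u, w)` and `b = g(A
  -- w u, v)`, the relations become `g(u, u) + a = 0`, `g(u, u) + b = 0` and `a + b = 0`.
  have h1 := hskew' v w u
  have h2 := hskew' w u v
  have h3 := hskew' u v w
  rw [hsymm p w v] at h2
  rw [hsymm p u w] at h3
  rw [hsymm p u v] at h3
  rw [hu] at h1 h2
  linarith

/-- The curvature of a connection with vanishing difference tensor. -/
lemma curvatureField_eq_zero {D : Connection n} (hD : ∀ p, diffTensor D p = 0)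
    {U V W : RSpace n → RSpace n} (hU : IsSmoothField U) (hV : IsSmoothField V)
    (hW : IsSmoothField W) (p : RSpace n) : curvatureField D U V W p = 0 := by
  have hnabla {X Y : RSpace n → RSpace n} (hY : IsSmoothField Y) :
      nabla D X Y = fun q => fderiv ℝ Y q (X q) - beta (X q) (Y q) • ez := by
    funext q
    rw [nabla_eq, cov_eq D hY, hD, LinearMap.zero_apply, LinearMap.zero_apply, add_zero]
  have hsm {X Y : RSpace n → RSpace n} (hX : IsSmoothField X) (hY : IsSmoothField Y) :
      IsSmoothField (fun q => fderiv ℝ Y q (X q) - beta (X q) (Y q) • (ez : RSpace n)) := by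
    refine ContDiff.sub (ContDiff.clm_apply (ContDiff.fderiv_right hY (by simp)) hX) ?_
    exact ((beta.contDiff.comp hX).clm_apply hY).smul contDiff_const
  have hfd {X Y : RSpace n → RSpace n} (hX : IsSmoothField X) (hY : IsSmoothField Y)
      (v : RSpace n) :
      fderiv ℝ (fun q => fderiv ℝ Y q (X q) - beta (X q) (Y q) • (ez : RSpace n)) p v
        = fderiv ℝ (fderiv ℝ Y) p v (X p) + fderiv ℝ Y p (fderiv ℝ X p v)
          - (beta (fderiv ℝ X p v) (Y p) + beta (X p) (fderiv ℝ Y p v)) • ez := by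
    have h1 := (hY.differentiable_fderiv p).hasFDerivAt.clm_apply
      (hX.differentiable p).hasFDerivAt
    have h2 := (beta.hasFDerivAt.comp p (hX.differentiable p).hasFDerivAt).clm_apply
      (hY.differentiable p).hasFDerivAt
    have h3 := (h1.sub (h2.smul_const (ez : RSpace n))).fderiv
    refine (congrArg (fun T : RSpace n →L[ℝ] RSpace n => T v) h3).trans ?_
    simp
    module
  have hsymm : fderiv ℝ (fderiv ℝ W) p (U p) (V p) = fderiv ℝ (fderiv ℝ W) p (V p) (U p) :=
    ((ContDiff.contDiffAt hW).isSymmSndFDerivAt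
      (by rw [minSmoothness_of_isRCLikeNormedField]; norm_cast)).eq _ _
  -- Second derivatives of `W` cancel by symmetry, and iterated `beta` terms vanish because `beta`
  -- kills `ez`.
  simp only [curvatureField, hnabla hW, hnabla (hsm hU hW), hnabla (hsm hV hW), hfd hU hW,
    hfd hV hW, lieBracket_eq, hsymm, map_sub, sub_apply, beta_ez_right, map_smul, smul_eq_mul,
    mul_zero, sub_zero]
  module

end SasakiR

end

theorem corollary5p1 (n : ℕ) (L : SasakiR.RSpace n → Submodule ℝ (SasakiR.RSpace n))
    (hL : SasakiR.IsLegendrianFoliation L)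
    (hflat : SasakiR.IsFlatFoliation L)
    (hQ : SasakiR.IsIntegrable (SasakiR.conjugate L))
    (D : SasakiR.Connection n)
    (hD : SasakiR.IsBiLegendrianConnection L (SasakiR.conjugate L) D)
    (hg : SasakiR.IsParallel D SasakiR.metric) :
    ∀ U V W : SasakiR.RSpace n → SasakiR.RSpace n,
      SasakiR.IsSmoothField U → SasakiR.IsSmoothField V → SasakiR.IsSmoothField W →
        ∀ p, SasakiR.curvatureField D U V W p = 0 := by
  intro U V W hU hV hW p
  exact SasakiR.curvatureField_eq_zero
    (SasakiR.diffTensor_eq_zero hg (hD.diffTensor_comm hL hflat hQ)) hU hV hW p
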